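/- Let $G$ be a finite group, $m$ an integer, and $\Xi$ the character of a finite-dimensional module $V$ over the Drinfeld double $D(G)$ over $\mathbb{C}$. Here $D(G)$ is the Hopf algebra with basis $e_g\# x$ ($g,x\in G$), product $(e_g\# x)(e_h\# y)=\delta_{g,xhx^{-1}}\,e_g\# xy$, unit $\sum_g e_g\# 1$, coproduct $\Delta(e_g\# x)=\sum_{ab=g}(e_a\# x)\otimes(e_b\# x)$, counit $\varepsilon(e_g\# x)=\delta_{g,1}$ and antipode $S(e_g\# x)=e_{x^{-1}g^{-1}x}\# x^{-1}$. Let $P(G)=\{(h,z)\in G^2: hz=zh\}$, on which $G$ acts by simultaneous conjugation, and view $\Xi$ as a function on $P(G)$ by $\Xi(h,z)=\operatorname{tr}(e_h\# z\,|\,V)$. For commuting $h,z$ put $$\gamma_m^z(h)=\bigl|\{x\in G: x^m=(hx)^m=z\}\bigr| .$$ Let $\nu_m(\Xi)=\Xi(\Lambda^{[m]})$ be the $m$-th Frobenius–Schur indicator, where $\Lambda$ is the two-sided integral of $D(G)$ with $\varepsilon(\Lambda)=1$ and $\Lambda^{[m]}$ is its $m$-th Sweedler power, i.e. the value at $\Lambda$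 of the $m$-th power of $\mathrm{id}_{D(G)}$ in the convolution algebra $\operatorname{End}_{\mathbb C}(D(G))$ (so $\Lambda^{[m]}=\Lambda_{(1)}\cdots\Lambda_{(m)}$ for $m>0$; negative powers are powers of the antipode). Then, for every set $R$ of representatives of the $G$-orbits on $P(G)$, $$\nu_m(\Xi)=\sum_{(h,z)\in R}\frac{1}{|C_G(h,z)|}\,\gamma_m^z(h)\,\Xi(h,z) =\frac1{|G|}\sum_{(h,z)\in P(G)}\gamma_m^z(h)\,\Xi(h,z),$$ where $C_G(h,z)$ is the set of elements of $G$ commuting with both $h$ and $z$. -/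

import Mathlib

open scoped TensorProduct

noncomputable section

/-! ## The Drinfeld double of a finite group -/

/-- The underlying vector space of the Drinfeld double `D(G)` over `ℂ`; an element is given by its
coefficients with respect to the basis `e_g # x` (`g, x ∈ G`), where `e_g ∈ ℂ^G` is the indicator
function of `g`. -/
def DrinfeldDouble (G : Type*) : Type _ := G × G → ℂ

namespace DrinfeldDouble

variable {G : Type*}

instance : AddCommGroup (DrinfeldDouble G) := inferInstanceAs (AddCommGroup (G × G → ℂ))

instance : Module ℂ (DrinfeldDouble G) := inferInstanceAs (Module ℂ (G × G → ℂ))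

@[ext]
theorem ext {a b : DrinfeldDouble G} (h : ∀ g x, a (g, x) = b (g, x)) : a = b :=
  funext fun p => h p.1 p.2

@[simp] theorem add_apply (a b : DrinfeldDouble G) (p : G × G) : (a + b) p = a p + b p := rfl

@[simp] theorem smul_apply (c : ℂ) (a : DrinfeldDouble G) (p : G × G) : (c • a) p = c * a p := rfl

@[simp] theorem zero_apply (p : G × G) : (0 : DrinfeldDouble G) p = 0 := rfl

set_option linter.unusedSectionVars false

variable [Group G] [Fintype G] [DecidableEq G]

/-- The basis of the vectors `e_g # x` of `D(G)`. -/
def basis (G : Type*) [Fintype G] [DecidableEq G] :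
    Module.Basis (G × G) ℂ (DrinfeldDouble G) := Pi.basisFun ℂ (G × G)

/-- The basis vector `e_g # x` of `D(G)`. -/
def single (g x : G) : DrinfeldDouble G := fun p => if p = (g, x) then 1 else 0

theorem basis_apply (p : G × G) : basis G p = single p.1 p.2 := by
  funext q
  have h : basis G p = Pi.single p (1 : ℂ) := Pi.basisFun_apply ℂ (G × G) p
  rw [h, Pi.single_apply]
  rfl

/-- The multiplication of `D(G)`; on the basis it is
`(e_g # x) (e_h # y) = δ_{g, x h x⁻¹} e_g # x y` (see `single_mul_single`). -/
instance : Mul (DrinfeldDouble G) :=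
  ⟨fun a b p => ∑ y, a (p.1, y) * b (y⁻¹ * p.1 * y, y⁻¹ * p.2)⟩

/-- The unit of `D(G)` is `∑_g e_g # 1`. -/
instance : One (DrinfeldDouble G) := ⟨fun p => if p.2 = 1 then 1 else 0⟩

theorem mul_apply (a b : DrinfeldDouble G) (g x : G) :
    (a * b) (g, x) = ∑ y, a (g, y) * b (y⁻¹ * g * y, y⁻¹ * x) := rfl

theorem one_apply (g x : G) : (1 : DrinfeldDouble G) (g, x) = if x = 1 then 1 else 0 := rfl

instance : Ring (DrinfeldDouble G) :=
  { (inferInstance : AddCommGroup (DrinfeldDouble G)),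
    (inferInstance : Mul (DrinfeldDouble G)),
    (inferInstance : One (DrinfeldDouble G)) with
    left_distrib := fun a b c => by
      ext g x; simp [mul_apply, mul_add, Finset.sum_add_distrib]
    right_distrib := fun a b c => by
      ext g x; simp [mul_apply, add_mul, Finset.sum_add_distrib]
    zero_mul := fun a => by ext g x; simp [mul_apply]
    mul_zero := fun a => by ext g x; simp [mul_apply]
    mul_assoc := fun a b c => by
      ext g x
      simp only [mul_apply, Finset.sum_mul, Finset.mul_sum]
      rw [Finset.sum_comm]
      refine Finset.sum_congr rfl fun y _ => ?_
      refine Fintype.sum_equiv (Equiv.mulLeft y⁻¹) _ _ fun z => ?_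
      simp [mul_assoc]
    one_mul := fun a => by
      ext g x
      simp [mul_apply, one_apply]
    mul_one := fun a => by
      ext g x
      simp [mul_apply, one_apply, inv_mul_eq_one] }

instance : Algebra ℂ (DrinfeldDouble G) :=
  Algebra.ofModule
    (fun c a b => by ext g x; simp [mul_apply, Finset.mul_sum, mul_assoc])
    (fun c a b => by
      ext g x; simp [mul_apply, Finset.mul_sum, mul_left_comm])

theorem single_mul_single (g x h y : G) :
    single g x * single h y = if g = x * h * x⁻¹ then single g (x * y) else 0 := by
  ext a z
  rw [mul_apply, Finset.sum_eq_single x]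
  · by_cases hg : a = g
    · subst hg
      have h1 : x⁻¹ * a * x = h ↔ a = x * h * x⁻¹ := by
        constructor
        · rintro rfl; group
        · rintro rfl; group
      have h2 : x⁻¹ * z = y ↔ z = x * y := inv_mul_eq_iff_eq_mul
      by_cases hc : a = x * h * x⁻¹
      · simp [single, h1, h2, ← hc]
      · simp [single, h1, hc]
    · split_ifs <;> simp [single, hg]
  · intro b _ hb
    simp [single, hb]
  · simp

theorem one_eq_sum : (1 : DrinfeldDouble G) = ∑ g, single g 1 := by
  ext a z
  have : (∑ g, single g (1 : G)) (a, z) = ∑ g, single g (1 : G) (a, z) :=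
    Finset.sum_apply (a, z) _ _
  rw [this, one_apply]
  simp [single, ite_and]

/-- The comultiplication of `D(G)`: `Δ(e_g # x) = ∑_{ab = g} (e_a # x) ⊗ (e_b # x)`. -/
def comulMap (G : Type*) [Group G] [Fintype G] [DecidableEq G] :
    DrinfeldDouble G →ₗ[ℂ] DrinfeldDouble G ⊗[ℂ] DrinfeldDouble G :=
  (basis G).constr ℂ fun p => ∑ a, single a p.2 ⊗ₜ[ℂ] single (a⁻¹ * p.1) p.2

/-- The counit of `D(G)`: `ε(e_g # x) = δ_{g, 1}`. -/
def counitMap (G : Type*) [Group G] [Fintype G] [DecidableEq G] : DrinfeldDouble G →ₗ[ℂ] ℂ :=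
  (basis G).constr ℂ fun p => if p.1 = 1 then 1 else 0

/-- The antipode of `D(G)`: `S(e_g # x) = e_{x⁻¹ g⁻¹ x} # x⁻¹`. -/
def antipodeMap (G : Type*) [Group G] [Fintype G] [DecidableEq G] :
    DrinfeldDouble G →ₗ[ℂ] DrinfeldDouble G :=
  (basis G).constr ℂ fun p => single (p.2⁻¹ * p.1⁻¹ * p.2) p.2⁻¹

theorem comulMap_single (g x : G) :
    comulMap G (single g x) = ∑ a, single a x ⊗ₜ[ℂ] single (a⁻¹ * g) x := by
  rw [← basis_apply (g, x), comulMap, Module.Basis.constr_basis]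

theorem counitMap_single (g x : G) : counitMap G (single g x) = if g = 1 then 1 else 0 := by
  rw [← basis_apply (g, x), counitMap, Module.Basis.constr_basis]

theorem antipodeMap_single (g x : G) :
    antipodeMap G (single g x) = single (x⁻¹ * g⁻¹ * x) x⁻¹ := by
  rw [← basis_apply (g, x), antipodeMap, Module.Basis.constr_basis]

instance : Coalgebra ℂ (DrinfeldDouble G) where
  comul := comulMap G
  counit := counitMap G
  coassoc := by
    refine (basis G).ext fun p => ?_
    obtain ⟨g, x⟩ := p
    simp only [basis_apply, LinearMap.comp_apply, comulMap_single, map_sum,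
      LinearMap.rTensor_tmul, LinearMap.lTensor_tmul, TensorProduct.sum_tmul,
      TensorProduct.tmul_sum, LinearEquiv.coe_coe, TensorProduct.assoc_tmul]
    rw [Finset.sum_comm]
    refine Finset.sum_congr rfl fun a _ => ?_
    refine Fintype.sum_equiv (Equiv.mulLeft a⁻¹) _ _ fun b => ?_
    simp [mul_assoc]
  rTensor_counit_comp_comul := by
    refine (basis G).ext fun p => ?_
    obtain ⟨g, x⟩ := p
    simp only [basis_apply, LinearMap.comp_apply, comulMap_single, map_sum,
      LinearMap.rTensor_tmul, counitMap_single, TensorProduct.mk_apply]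
    rw [Finset.sum_eq_single 1] <;> simp +contextual
  lTensor_counit_comp_comul := by
    refine (basis G).ext fun p => ?_
    obtain ⟨g, x⟩ := p
    simp only [basis_apply, LinearMap.comp_apply, comulMap_single, map_sum,
      LinearMap.lTensor_tmul, counitMap_single, TensorProduct.mk_apply, LinearMap.flip_apply]
    rw [Finset.sum_eq_single g] <;> simp +contextual [inv_mul_eq_one]

theorem comul_single (g x : G) :
    Coalgebra.comul (R := ℂ) (single g x) = ∑ a, single a x ⊗ₜ[ℂ] single (a⁻¹ * g) x :=
  comulMap_single g x

theorem counit_single (g x : G) :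
    Coalgebra.counit (R := ℂ) (single g x) = if g = 1 then 1 else 0 :=
  counitMap_single g x

theorem comul_single_mul (g x h y : G) :
    Coalgebra.comul (R := ℂ) (single g x * single h y) =
      Coalgebra.comul (R := ℂ) (single g x) * Coalgebra.comul (R := ℂ) (single h y) := by
  rw [single_mul_single, comul_single, comul_single, Finset.sum_mul_sum]
  simp only [Algebra.TensorProduct.tmul_mul_tmul, single_mul_single]
  have key : ∀ a : G, (∑ b : G, (if a = x * b * x⁻¹ then single a (x * y) else 0) ⊗ₜ[ℂ]
      (if a⁻¹ * g = x * (b⁻¹ * h) * x⁻¹ then single (a⁻¹ * g) (x * y) else 0)) =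
      if g = x * h * x⁻¹ then single a (x * y) ⊗ₜ[ℂ] single (a⁻¹ * g) (x * y) else 0 := by
    intro a
    rw [Finset.sum_eq_single (x⁻¹ * a * x)]
    · have h1 : a = x * (x⁻¹ * a * x) * x⁻¹ := by group
      have h2 : a⁻¹ * g = x * ((x⁻¹ * a * x)⁻¹ * h) * x⁻¹ ↔ g = x * h * x⁻¹ := by
        have : x * ((x⁻¹ * a * x)⁻¹ * h) * x⁻¹ = a⁻¹ * (x * h * x⁻¹) := by group
        rw [this, mul_right_inj]
      rw [if_pos h1]
      simp only [h2]
      split_ifs <;> simp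
    · intro b _ hb
      have : a ≠ x * b * x⁻¹ := by
        rintro rfl
        exact hb (by group)
      simp [this]
    · simp
  rw [Finset.sum_congr rfl fun a _ => key a]
  split_ifs
  · rw [comul_single]
  · simp

instance : Bialgebra ℂ (DrinfeldDouble G) where
  counit_one := by
    rw [one_eq_sum, map_sum]
    simp [counit_single]
  mul_compr₂_counit := by
    refine (basis G).ext fun p => (basis G).ext fun q => ?_
    obtain ⟨g, x⟩ := p
    obtain ⟨h, y⟩ := q
    simp only [basis_apply, LinearMap.compr₂_apply, LinearMap.compl₁₂_apply, LinearMap.mul_apply',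
      counit_single, single_mul_single, apply_ite (Coalgebra.counit (R := ℂ)), map_zero]
    by_cases hg : g = 1
    · subst hg
      have : 1 = x * h * x⁻¹ ↔ h = 1 := by
        rw [eq_mul_inv_iff_mul_eq, one_mul, eq_comm, mul_eq_left]
      simp [this]
    · simp [hg]
  comul_one := by
    rw [one_eq_sum, map_sum, Algebra.TensorProduct.one_def, one_eq_sum]
    simp only [comul_single, TensorProduct.sum_tmul, TensorProduct.tmul_sum]
    rw [Finset.sum_comm]
    conv_rhs => rw [Finset.sum_comm]
    refine Finset.sum_congr rfl fun a _ => ?_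
    exact Fintype.sum_equiv (Equiv.mulLeft a⁻¹) _ _ fun b => by simp
  mul_compr₂_comul := by
    refine (basis G).ext fun p => (basis G).ext fun q => ?_
    rw [basis_apply, basis_apply]
    exact comul_single_mul p.1 p.2 q.1 q.2

/-- The Hopf algebra structure of `D(G)`. -/
instance : HopfAlgebra ℂ (DrinfeldDouble G) where
  antipode := antipodeMap G
  mul_antipode_rTensor_comul := by
    refine (basis G).ext fun p => ?_
    obtain ⟨g, x⟩ := p
    simp only [basis_apply, LinearMap.comp_apply, comul_single, map_sum,
      LinearMap.rTensor_tmul, antipodeMap_single, LinearMap.mul'_apply, single_mul_single,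
      counit_single, Algebra.linearMap_apply]
    have h : ∀ a : G, x⁻¹ * a⁻¹ * x = x⁻¹ * (a⁻¹ * g) * x⁻¹⁻¹ ↔ g = 1 := by
      intro a
      rw [inv_inv, mul_left_inj, mul_right_inj, eq_comm, mul_eq_left]
    simp only [h, inv_mul_cancel]
    split_ifs
    · rw [map_one, one_eq_sum]
      exact Fintype.sum_equiv (((Equiv.inv G).trans (Equiv.mulLeft x⁻¹)).trans
        (Equiv.mulRight x)) _ _ fun a => by simp
    · simp
  mul_antipode_lTensor_comul := by
    refine (basis G).ext fun p => ?_
    obtain ⟨g, x⟩ := p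
    simp only [basis_apply, LinearMap.comp_apply, comul_single, map_sum,
      LinearMap.lTensor_tmul, antipodeMap_single, LinearMap.mul'_apply, single_mul_single,
      counit_single, Algebra.linearMap_apply]
    have h : ∀ a : G, a = x * (x⁻¹ * (a⁻¹ * g)⁻¹ * x) * x⁻¹ ↔ g = 1 := by
      intro a
      have : x * (x⁻¹ * (a⁻¹ * g)⁻¹ * x) * x⁻¹ = g⁻¹ * a := by group
      rw [this, eq_comm, mul_eq_right, inv_eq_one]
    simp only [h, mul_inv_cancel]
    split_ifs
    · rw [map_one, one_eq_sum]
    · simp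

end DrinfeldDouble

/-! ## Sweedler powers, integrals, characters and Frobenius-Schur indicators -/

/-- The `m`-th Sweedler power map of a Hopf algebra, that is, the `m`-th power of the identity in
the convolution algebra `Hom(H, H)`, whose inverse there is the antipode. So for `m > 0`
it is `x ↦ x₍₁₎ x₍₂₎ ⋯ x₍ₘ₎`, for `m = 0` it is `x ↦ ε(x) 1`, and for `m < 0` it is
`x ↦ S(x₍₁₎) ⋯ S(x₍₋ₘ₎)`. -/
def sweedlerPower {k H : Type*} [CommRing k] [Ring H] [HopfAlgebra k H] : ℤ → H →ₗ[k] H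
  | Int.ofNat n => ((WithConv.toConv (LinearMap.id : H →ₗ[k] H)) ^ n).ofConv
  | Int.negSucc n => ((WithConv.toConv (HopfAlgebra.antipode k : H →ₗ[k] H)) ^ (n + 1)).ofConv

/-- `Λ` is a two-sided integral of the Hopf algebra `H`, normalized by `ε(Λ) = 1`. -/
structure IsNormalizedIntegral (k : Type*) {H : Type*} [CommRing k] [Ring H] [HopfAlgebra k H]
    (Λ : H) : Prop where
  mul_left (a : H) : a * Λ = Coalgebra.counit (R := k) a • Λ
  mul_right (a : H) : Λ * a = Coalgebra.counit (R := k) a • Λ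
  counit_eq_one : Coalgebra.counit (R := k) Λ = 1

namespace DrinfeldDouble

variable {G : Type*} [Group G] [Fintype G] [DecidableEq G]

/-- The normalized integral `(1 / |G|) ∑_x e_1 # x` of `D(G)`. -/
def integral (G : Type*) [Group G] [Fintype G] [DecidableEq G] : DrinfeldDouble G :=
  (1 / (Nat.card G : ℂ)) • ∑ x, single 1 x

/-- `integral G` is the unique normalized integral of the Hopf algebra `D(G)`. -/
theorem isNormalizedIntegral_iff (Λ : DrinfeldDouble G) :
    IsNormalizedIntegral ℂ Λ ↔ Λ = integral G := by
  have hI : IsNormalizedIntegral ℂ (integral G) := by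
    refine ⟨fun a => ?_, fun a => ?_, ?_⟩
    · have : LinearMap.mulRight ℂ (integral G) =
          (Coalgebra.counit (R := ℂ) (A := DrinfeldDouble G)).smulRight (integral G) := by
        refine (basis G).ext fun p => ?_
        obtain ⟨g, x⟩ := p
        simp only [basis_apply, LinearMap.mulRight_apply, LinearMap.smulRight_apply,
          counit_single, integral, mul_smul_comm, Finset.mul_sum, single_mul_single,
          mul_one, mul_inv_cancel]
        split_ifs with hg
        · subst hg
          rw [one_smul]
          congr 1
          exact Fintype.sum_equiv (Equiv.mulLeft x) _ _ fun b => by simp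
        · simp
      exact LinearMap.congr_fun this a
    · have : LinearMap.mulLeft ℂ (integral G) =
          (Coalgebra.counit (R := ℂ) (A := DrinfeldDouble G)).smulRight (integral G) := by
        refine (basis G).ext fun p => ?_
        obtain ⟨g, x⟩ := p
        have h : ∀ y : G, 1 = y * g * y⁻¹ ↔ g = 1 := fun y => by
          rw [eq_mul_inv_iff_mul_eq, one_mul, eq_comm, mul_eq_left]
        simp only [basis_apply, LinearMap.mulLeft_apply, LinearMap.smulRight_apply,
          counit_single, integral, smul_mul_assoc, Finset.sum_mul, single_mul_single, h]
        split_ifs with hg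
        · rw [one_smul]
          congr 1
          exact Fintype.sum_equiv (Equiv.mulRight x) _ _ fun b => by simp
        · simp
      exact LinearMap.congr_fun this a
    · have : (Fintype.card G : ℂ) ≠ 0 := by exact_mod_cast Fintype.card_ne_zero
      simp [integral, map_sum, counit_single, this]
  constructor
  · intro h
    have h1 := h.mul_left (integral G)
    have h2 := hI.mul_right Λ
    rw [hI.counit_eq_one, one_smul] at h1
    rw [h.counit_eq_one, one_smul] at h2
    exact h1.symm.trans h2
  · rintro rfl
    exact hI

/-- The character of a `D(G)`-module `V`: the linear form `a ↦ tr (a | V)` on `D(G)`. -/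
def character (G : Type*) [Group G] [Fintype G] [DecidableEq G] (V : Type*) [AddCommGroup V]
    [Module ℂ V] [Module (DrinfeldDouble G) V] [IsScalarTower ℂ (DrinfeldDouble G) V] :
    DrinfeldDouble G →ₗ[ℂ] ℂ :=
  LinearMap.trace ℂ V ∘ₗ (Algebra.lsmul ℂ ℂ V : DrinfeldDouble G →ₐ[ℂ] Module.End ℂ V).toLinearMap

/-- The `m`-th Frobenius-Schur indicator of a `D(G)`-module `V`: the value of its character on
the `m`-th Sweedler power of the normalized integral. -/
def indicator (G : Type*) [Group G] [Fintype G] [DecidableEq G] (m : ℤ) (V : Type*)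
    [AddCommGroup V] [Module ℂ V] [Module (DrinfeldDouble G) V]
    [IsScalarTower ℂ (DrinfeldDouble G) V] : ℂ :=
  character G V (sweedlerPower (k := ℂ) m (integral G))

end DrinfeldDouble

/-! ## Commuting pairs and the functions `γ_m^z` -/

/-- The set `P(G)` of pairs of commuting elements. -/
abbrev CommutingPair (G : Type*) [Group G] : Type _ := {p : G × G // p.1 * p.2 = p.2 * p.1}

/-- `p` and `q` lie in the same orbit of `G` acting on `P(G)` by simultaneous conjugation. -/
def CommutingPair.SameOrbit {G : Type*} [Group G] (p q : CommutingPair G) : Prop :=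
  ∃ t : G, t * p.1.1 * t⁻¹ = q.1.1 ∧ t * p.1.2 * t⁻¹ = q.1.2

/-- `R` consists of exactly one representative of each orbit of `G` on `P(G)`. -/
def IsOrbitRepresentatives {G : Type*} [Group G] (R : Finset (CommutingPair G)) : Prop :=
  ∀ p : CommutingPair G, ∃! r : CommutingPair G, r ∈ R ∧ p.SameOrbit r

/-- The set `G_m(g, z) = {x ∈ G | x ^ m = (g x) ^ m = z}`. -/
def powerSolutions {G : Type*} [Group G] (m : ℤ) (g z : G) : Set G :=
  {x | x ^ m = z ∧ (g * x) ^ m = z}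

/-- The function `γ_m^z : C_G(z) → ℂ`, `g ↦ |G_m(g, z)|`. -/
def gammaFunction {G : Type*} [Group G] (m : ℤ) (z : G) (g : Subgroup.centralizer ({z} : Set G)) :
    ℂ :=
  (Nat.card (powerSolutions m (g : G) z) : ℂ)

/-- The value `γ_m^z(h)` at a commuting pair `(h, z)`. -/
def CommutingPair.gamma {G : Type*} [Group G] (m : ℤ) (p : CommutingPair G) : ℂ :=
  gammaFunction m p.1.2 ⟨p.1.1, Subgroup.mem_centralizer_singleton_iff.mpr p.2⟩

/-- The character `Ξ` of a `D(G)`-module `V`, viewed as a function on commuting pairs: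
`Ξ(h, z)` is the trace of `e_h # z` on `V`, that is, the trace of `z` on the component
`e_h V`. -/
def CommutingPair.characterValue {G : Type*} [Group G] [Fintype G] [DecidableEq G]
    (V : Type*) [AddCommGroup V] [Module ℂ V] [Module (DrinfeldDouble G) V]
    [IsScalarTower ℂ (DrinfeldDouble G) V] (p : CommutingPair G) : ℂ :=
  DrinfeldDouble.character G V (DrinfeldDouble.single p.1.1 p.1.2)

end

/-! Iterating the coproduct, for `m > 0` the `m`-th Sweedler power of `e_g # x` is the sum of the
products `(e_{a₁} # x) ⋯ (e_{aₘ} # x)` with `a₁ ⋯ aₘ = g`. Such a product vanishes unless `aᵢ = x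
aᵢ₊₁ x⁻¹` for all `i`. So `b = a₁` determines every factor, the product is `e_b # x^m`, and the
constraint telescopes to `(b x⁻¹)^m x^m = g`. This formula, `IsPowerMap`, makes sense for every
integer `m`. It is stable under convolution and holds for the identity and the antipode, hence for
all Sweedler powers.

At the integral `g = 1`, and the substitution `x = h y` with `h = b` turns the constraint into `(h
y)^m = y^m`. Grouping the solutions by the common value `z = y^m`, which necessarily commutes with
`h`, produces `γ_m^z(h)`. The sum over representatives follows by orbit-stabilizer, since `γ` and
the character are constant on orbits. -/

/-! ### Sweedler powers on the basis -/

namespace DrinfeldDouble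

variable {G : Type*} [Group G] [Fintype G] [DecidableEq G]

/-- The closed formula for the `m`-th Sweedler power on the basis of `D(G)`. -/
def IsPowerMap (m : ℤ) (P : DrinfeldDouble G →ₗ[ℂ] DrinfeldDouble G) : Prop :=
  ∀ g x : G, P (single g x) =
    ∑ b, if (b * x⁻¹) ^ m * x ^ m = g then single b (x ^ m) else 0

theorem isPowerMap_id : IsPowerMap (G := G) 1 LinearMap.id := by
  intro g x
  simp

theorem isPowerMap_antipode : IsPowerMap (G := G) (-1) (HopfAlgebra.antipode ℂ) := by
  intro g x
  have h (b : G) : (b * x⁻¹) ^ (-1 : ℤ) * x ^ (-1 : ℤ) = g ↔ b = x⁻¹ * g⁻¹ * x := by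
    simp only [zpow_neg_one, mul_inv_rev, inv_inv]
    constructor
    · rintro rfl; group
    · rintro rfl; group
  simp only [h, Finset.sum_ite_eq', Finset.mem_univ, if_true]
  rw [zpow_neg, zpow_one]
  exact antipodeMap_single g x

theorem isPowerMap_one :
    IsPowerMap 0 (1 : WithConv (DrinfeldDouble G →ₗ[ℂ] DrinfeldDouble G)).ofConv := by
  intro g x
  rw [LinearMap.convOne_apply, counit_single]
  by_cases hg : g = 1
  · simp [hg, one_eq_sum]
  · simp [hg, Ne.symm hg]

/-- The factors `e_b # x^m` and `e_{b'} # x^k` have nonzero product only if `b = x^m b' x^{-m}`.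
Since `x^m` commutes with `x`, this also conjugates `b' x⁻¹` to `b x⁻¹`, so the two constraints
merge into the one for `m + k`. -/
theorem IsPowerMap.mul {m k : ℤ} {P Q : WithConv (DrinfeldDouble G →ₗ[ℂ] DrinfeldDouble G)}
    (hP : IsPowerMap m P.ofConv) (hQ : IsPowerMap k Q.ofConv) :
    IsPowerMap (m + k) (P * Q).ofConv := by
  intro g x
  have key (b b' : G) (h : b = x ^ m * b' * (x ^ m)⁻¹) :
      (b * x⁻¹) ^ m * x ^ m * ((b' * x⁻¹) ^ k * x ^ k) =
        (b * x⁻¹) ^ (m + k) * x ^ (m + k) := by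
    have hc : b * x⁻¹ = x ^ m * (b' * x⁻¹) * (x ^ m)⁻¹ := by
      rw [h]; group
    have hk : (b * x⁻¹) ^ k = x ^ m * (b' * x⁻¹) ^ k * (x ^ m)⁻¹ := by
      rw [hc, conj_zpow]
    rw [zpow_add, zpow_add, hk]
    group
  rw [LinearMap.convMul_apply, comul_single]
  simp only [map_sum, TensorProduct.map_tmul, LinearMap.mul'_apply, hP _ x, hQ _ x,
    Finset.sum_mul]
  rw [Finset.sum_comm]
  refine Finset.sum_congr rfl fun b _ => ?_
  simp only [ite_mul, zero_mul, Finset.sum_ite_eq, Finset.mem_univ, if_true]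
  simp only [Finset.mul_sum, mul_ite, mul_zero, single_mul_single, ← zpow_add]
  -- For fixed `b`, this is the only `b'` giving a nonzero product.
  rw [Finset.sum_eq_single ((x ^ m)⁻¹ * b * x ^ m)]
  · have hb : b = x ^ m * ((x ^ m)⁻¹ * b * x ^ m) * (x ^ m)⁻¹ := by group
    rw [if_pos hb, ← key b _ hb]
    simp only [eq_inv_mul_iff_mul_eq]
  · intro b' _ hb'
    rw [if_neg (c := b = _), ite_self]
    rintro rfl
    exact hb' (by group)
  · simp

theorem IsPowerMap.pow {m : ℤ} {P : WithConv (DrinfeldDouble G →ₗ[ℂ] DrinfeldDouble G)}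
    (hP : IsPowerMap m P.ofConv) (n : ℕ) : IsPowerMap (n * m) (P ^ n).ofConv := by
  induction n with
  | zero => simpa using isPowerMap_one
  | succ n ih =>
    rw [pow_succ, Nat.cast_succ, add_mul, one_mul]
    exact ih.mul hP

theorem isPowerMap_sweedlerPower (m : ℤ) :
    IsPowerMap (G := G) m (sweedlerPower (k := ℂ) m) := by
  cases m with
  | ofNat n =>
    have := IsPowerMap.pow (P := WithConv.toConv LinearMap.id) (isPowerMap_id (G := G)) n
    rw [mul_one] at this
    exact this
  | negSucc n =>
    have := IsPowerMap.pow (P := WithConv.toConv (HopfAlgebra.antipode ℂ))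
      (isPowerMap_antipode (G := G)) (n + 1)
    have hm : Int.negSucc n = ((n + 1 : ℕ) : ℤ) * -1 := by
      rw [Int.negSucc_eq]; push_cast; ring
    rw [← hm] at this
    exact this

/-! ### The indicator as a character sum -/

variable (V : Type*) [AddCommGroup V] [Module ℂ V] [Module (DrinfeldDouble G) V]
  [IsScalarTower ℂ (DrinfeldDouble G) V]

theorem indicator_eq_sum (m : ℤ) :
    indicator G m V = 1 / (Nat.card G : ℂ) *
      ∑ h : G, ∑ y : G, if (h * y) ^ m = y ^ m then character G V (single h (y ^ m)) else 0 := by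
  rw [indicator, integral, map_smul, map_smul, smul_eq_mul, map_sum, map_sum]
  congr 1
  simp only [isPowerMap_sweedlerPower m _ _, map_sum]
  rw [Finset.sum_comm]
  refine Finset.sum_congr rfl fun h _ => ?_
  -- Set `y = h⁻¹ x`. Then `h x⁻¹` is the inverse of the conjugate `x y x⁻¹`, and this conjugation
  -- fixes `x^m`, so the constraint reads `x^m = y^m`.
  refine Fintype.sum_equiv (Equiv.mulLeft h⁻¹) _ _ fun x => ?_
  have hconj : x * (h⁻¹ * x) ^ m * x⁻¹ = ((h * x⁻¹) ^ m)⁻¹ := by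
    rw [← conj_zpow, ← inv_zpow]
    congr 1
    group
  have hiff : (h * x⁻¹) ^ m * x ^ m = 1 ↔ x ^ m = (h⁻¹ * x) ^ m := by
    rw [mul_eq_one_iff_inv_eq, ← hconj, mul_inv_eq_iff_eq_mul,
      ← (Commute.refl x).zpow_right m |>.eq, mul_right_inj, eq_comm]
  simp only [Equiv.coe_mulLeft, mul_inv_cancel_left, hiff]
  split_ifs with hx
  · rw [hx]
  · simp

theorem character_mul_comm (a b : DrinfeldDouble G) :
    character G V (a * b) = character G V (b * a) := by
  simp only [character, LinearMap.comp_apply, AlgHom.toLinearMap_apply, map_mul]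
  exact LinearMap.trace_mul_comm ℂ _ _

/-- Both basis vectors are products of the same two factors in opposite orders. Commutativity of `h`
and `z` makes the second product nonzero. -/
theorem character_single_conj {h z : G} (hz : h * z = z * h) (t : G) :
    character G V (single (t * h * t⁻¹) (t * z * t⁻¹)) = character G V (single h z) := by
  have h1 : single (t * h * t⁻¹) t * single h (z * t⁻¹) =
      single (t * h * t⁻¹) (t * z * t⁻¹) := by
    rw [single_mul_single, if_pos rfl, ← mul_assoc]
  have h2 : single h (z * t⁻¹) * single (t * h * t⁻¹) t = single h z := by
    rw [single_mul_single, if_pos, inv_mul_cancel_right]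
    have : z * t⁻¹ * (t * h * t⁻¹) * (z * t⁻¹)⁻¹ = z * h * z⁻¹ := by group
    rw [this, ← hz, mul_inv_cancel_right]
  rw [← h1, character_mul_comm, h2]

end DrinfeldDouble

/-- The common power commutes with both `h y` and `y`, hence with their quotient `h`. -/
theorem mul_comm_of_mul_zpow_eq {G : Type*} [Group G] {m : ℤ} {h y : G}
    (hy : (h * y) ^ m = y ^ m) : h * y ^ m = y ^ m * h := by
  have h1 : Commute (h * y) (y ^ m) := hy ▸ (Commute.refl (h * y)).zpow_right m
  have h2 : Commute y (y ^ m) := (Commute.refl y).zpow_right m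
  have h3 := h1.mul_left h2.inv_left
  rwa [mul_inv_cancel_right] at h3

/-! ### Orbits of commuting pairs -/

namespace CommutingPair

variable {G : Type*} [Group G]

theorem SameOrbit.natCard_powerSolutions_eq {p q : CommutingPair G} (hpq : p.SameOrbit q) (m : ℤ) :
    Nat.card (powerSolutions m p.1.1 p.1.2) = Nat.card (powerSolutions m q.1.1 q.1.2) := by
  obtain ⟨t, h1, h2⟩ := hpq
  refine Nat.card_congr ((MulAut.conj t).toEquiv.subtypeEquiv fun x => ?_)
  change _ ∧ _ ↔ (MulAut.conj t x) ^ m = _ ∧ (_ * MulAut.conj t x) ^ m = _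
  rw [← h1, ← h2, ← MulAut.conj_apply, ← MulAut.conj_apply, ← map_mul, ← map_zpow, ← map_zpow,
    EmbeddingLike.apply_eq_iff_eq, EmbeddingLike.apply_eq_iff_eq]

theorem SameOrbit.gamma_eq {p q : CommutingPair G} (hpq : p.SameOrbit q) (m : ℤ) :
    p.gamma m = q.gamma m := by
  simp only [gamma, gammaFunction, hpq.natCard_powerSolutions_eq m]

/-- Orbit-stabilizer for simultaneous conjugation: the stabilizer of a pair is its centralizer. -/
theorem natCard_sameOrbit_mul_natCard_centralizer (r : CommutingPair G) :
    Nat.card {p : CommutingPair G // p.SameOrbit r} *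
      Nat.card (Subgroup.centralizer ({r.1.1, r.1.2} : Set G)) = Nat.card G := by
  have e1 : MulAction.orbit (ConjAct G) r.1 ≃ {p : CommutingPair G // p.SameOrbit r} :=
    { toFun := fun q => ⟨⟨q.1, by
          obtain ⟨q, t, rfl⟩ := q
          change t • r.1.1 * t • r.1.2 = t • r.1.2 * t • r.1.1
          rw [← smul_mul', ← smul_mul', r.2]⟩, by
          obtain ⟨q, t, rfl⟩ := q
          -- `SameOrbit` conjugates `p` to `r`, while the orbit carries `r` to `p`; hence the
          -- inverse.
          refine ⟨(ConjAct.ofConjAct t)⁻¹, ?_, ?_⟩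
          · simp [ConjAct.smul_def, mul_assoc]
          · simp [ConjAct.smul_def, mul_assoc]⟩
      invFun := fun p => ⟨p.1.1, by
          obtain ⟨t, h1, h2⟩ := p.2
          refine ⟨(ConjAct.toConjAct t)⁻¹, Prod.ext ?_ ?_⟩
          · simp [ConjAct.smul_def, ← h1, mul_assoc]
          · simp [ConjAct.smul_def, ← h2, mul_assoc]⟩
      left_inv := fun _ => rfl
      right_inv := fun _ => rfl }
  have e2 : MulAction.stabilizer (ConjAct G) r.1 ≃
      Subgroup.centralizer ({r.1.1, r.1.2} : Set G) :=
    ConjAct.ofConjAct.toEquiv.subtypeEquiv fun t => by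
      simp [MulAction.mem_stabilizer_iff, Prod.ext_iff, ConjAct.smul_def,
        Subgroup.mem_centralizer_iff, mul_inv_eq_iff_eq_mul, eq_comm (a := r.1.1 * _),
        eq_comm (a := r.1.2 * _)]
  rw [← Nat.card_congr e1, ← Nat.card_congr e2, ← Nat.card_prod,
    Nat.card_congr (MulAction.orbitProdStabilizerEquivGroup (ConjAct G) r.1)]
  exact Nat.card_congr ConjAct.ofConjAct.toEquiv

variable [Fintype G] [DecidableEq G]

theorem sum_eq_sum_orbitRepresentatives {R : Finset (CommutingPair G)}
    (hR : IsOrbitRepresentatives R) (F : CommutingPair G → ℂ)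
    (hF : ∀ p q : CommutingPair G, p.SameOrbit q → F p = F q) :
    1 / (Nat.card G : ℂ) * ∑ p, F p =
      ∑ r ∈ R, 1 / (Nat.card (Subgroup.centralizer ({r.1.1, r.1.2} : Set G)) : ℂ) * F r := by
  classical
  -- Each `p` is counted once, at its unique representative.
  have hsum : ∑ p, F p = ∑ r ∈ R, ∑ p, if p.SameOrbit r then F p else 0 := by
    rw [Finset.sum_comm]
    refine Finset.sum_congr rfl fun p _ => ?_
    obtain ⟨r, ⟨hr, hpr⟩, hu⟩ := hR p
    rw [Finset.sum_eq_single_of_mem r hr, if_pos hpr]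
    intro r' hr' hne
    exact if_neg fun h => hne (hu r' ⟨hr', h⟩)
  rw [hsum, Finset.mul_sum]
  refine Finset.sum_congr rfl fun r _ => ?_
  have hcount : (∑ p, if p.SameOrbit r then F p else 0) =
      Nat.card {p : CommutingPair G // p.SameOrbit r} * F r := by
    rw [← Finset.sum_filter, Finset.sum_congr rfl fun p hp => hF p r (Finset.mem_filter.mp hp).2,
      Finset.sum_const, nsmul_eq_mul, Nat.card_eq_fintype_card, Fintype.card_subtype]
  have hc : (Nat.card (Subgroup.centralizer ({r.1.1, r.1.2} : Set G)) : ℂ) ≠ 0 :=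
    Nat.cast_ne_zero.mpr Nat.card_pos.ne'
  have ho : (Nat.card {p : CommutingPair G // p.SameOrbit r} : ℂ) ≠ 0 := by
    have : Nonempty {p : CommutingPair G // p.SameOrbit r} := ⟨⟨r, 1, by simp, by simp⟩⟩
    exact Nat.cast_ne_zero.mpr Nat.card_pos.ne'
  rw [hcount, ← natCard_sameOrbit_mul_natCard_centralizer r, Nat.cast_mul]
  field_simp

/-! ### Regrouping by the common power -/

variable (V : Type*) [AddCommGroup V] [Module ℂ V] [Module (DrinfeldDouble G) V]
  [IsScalarTower ℂ (DrinfeldDouble G) V]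

theorem SameOrbit.characterValue_eq {p q : CommutingPair G} (hpq : p.SameOrbit q) :
    p.characterValue V = q.characterValue V := by
  obtain ⟨t, h1, h2⟩ := hpq
  rw [characterValue, characterValue, ← h1, ← h2, DrinfeldDouble.character_single_conj V p.2]

theorem gamma_eq_sum (m : ℤ) (p : CommutingPair G) :
    p.gamma m = ∑ y : G, if y ^ m = p.1.2 ∧ (p.1.1 * y) ^ m = p.1.2 then 1 else 0 := by
  rw [Finset.sum_boole, ← Fintype.card_subtype, ← Nat.card_eq_fintype_card]
  rfl

theorem sum_gamma_mul_characterValue (m : ℤ) :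
    ∑ p : CommutingPair G, p.gamma m * p.characterValue V =
      ∑ h : G, ∑ y : G, if (h * y) ^ m = y ^ m then
        DrinfeldDouble.character G V (DrinfeldDouble.single h (y ^ m)) else 0 := by
  have hext : ∑ p : CommutingPair G, p.gamma m * p.characterValue V =
      ∑ p : G × G, ∑ y : G, if y ^ m = p.2 ∧ (p.1 * y) ^ m = p.2 then
        DrinfeldDouble.character G V (DrinfeldDouble.single p.1 p.2) else 0 := by
    -- The sum over `P(G)` extends to all of `G × G`: a pair with a nonzero term has a solution `y`,
    -- which forces it to commute.
    rw [← Fintype.sum_subset (s := Finset.univ.filter fun p : G × G => p.1 * p.2 = p.2 * p.1),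
      Finset.sum_subtype _ (p := fun p : G × G => p.1 * p.2 = p.2 * p.1) (by simp)]
    · refine Finset.sum_congr rfl fun p _ => ?_
      simp only [gamma_eq_sum, Finset.sum_mul, ite_mul, one_mul, zero_mul]
      rfl
    · intro p hp
      obtain ⟨y, _, hy⟩ := Finset.exists_ne_zero_of_sum_ne_zero hp
      obtain ⟨hy1, hy2⟩ := (ite_ne_right_iff.mp hy).1
      rw [Finset.mem_filter]
      exact ⟨Finset.mem_univ p, hy1 ▸ mul_comm_of_mul_zpow_eq (hy2.trans hy1.symm)⟩
  rw [hext, Fintype.sum_prod_type]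
  refine Finset.sum_congr rfl fun h _ => ?_
  rw [Finset.sum_comm]
  refine Finset.sum_congr rfl fun y _ => ?_
  simp [ite_and]

end CommutingPair

theorem mainTheorem2 {G : Type*} [Group G] [Fintype G] [DecidableEq G] (m : ℤ)
    (V : Type*) [AddCommGroup V] [Module ℂ V] [FiniteDimensional ℂ V]
    [Module (DrinfeldDouble G) V] [IsScalarTower ℂ (DrinfeldDouble G) V] :
    (∀ R : Finset (CommutingPair G), IsOrbitRepresentatives R →
      DrinfeldDouble.indicator G m V =
        ∑ p ∈ R, 1 / (Nat.card (Subgroup.centralizer ({p.1.1, p.1.2} : Set G)) : ℂ) *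
          p.gamma m * p.characterValue V) ∧
    DrinfeldDouble.indicator G m V =
      1 / (Nat.card G : ℂ) * ∑ p : CommutingPair G, p.gamma m * p.characterValue V := by
  have hsum : DrinfeldDouble.indicator G m V =
      1 / (Nat.card G : ℂ) * ∑ p : CommutingPair G, p.gamma m * p.characterValue V := by
    rw [DrinfeldDouble.indicator_eq_sum, CommutingPair.sum_gamma_mul_characterValue]
  refine ⟨fun R hR => ?_, hsum⟩
  rw [hsum, CommutingPair.sum_eq_sum_orbitRepresentatives hR _ fun p q hpq => by
    rw [hpq.gamma_eq m, hpq.characterValue_eq V]]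
  simp only [mul_assoc]
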